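/- For $q\in\mathbb{C}$ with $0<|q|<1$ and $x,y\in\mathbb{C}\setminus\{0\}$ let $$j(x;q)=\sum_{n\in\mathbb{Z}}(-1)^nq^{\binom n2}x^n,\qquad J_{a,m}=j(q^a;q^m),\qquad J_m=J_{m,3m}=\prod_{i\ge1}(1-q^{mi}),$$ $$f_{a,b,c}(x,y,q)=\Big(\sum_{r,s\ge0}-\sum_{r,s<0}\Big)(-1)^{r+s}x^ry^sq^{a\binom r2+brs+c\binom s2}.$$ Then, for all $q$ with $0<|q|<1$, the double sum $f_{4,4,1}(q^4,q^3,q)$ converges absolutely and $$f_{4,4,1}(q^4,q^3,q)=J_2\,J_{3,12}.$$ This is equivalent to the Kac–Peterson evaluation of the level-$6$ string function $c_{51}^{33}$ of the affine algebra $A_1^{(1)}$. For $\tau$ in the upper half-plane let $q^x=e^{2\pi i x\tau}$ for real $x$, let $\eta(\tau)=q^{1/24}\prod_{n\ge1}(1-q^n)$, and let the string function be given by the Kac–Peterson formula (level $N$, with $\mathrm{sg}(x)=1$ for $x\ge0$ and $\mathrm{sg}(x)=-1$ for $x<0$) $$c^{N-\ell,\ell}_{N-m,m}(\tau)=\frac1{\eta(\tau)^3}\sum_{\substack{(x,y)\in\mathbb{R}^2,\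 -|x|<y\le|x|\\ (x,y)\text{ or }(\frac12-x,\frac12+y)\,\in\,\left(\frac{\ell+1}{2(N+2)},\frac m{2N}\right)+\mathbb{Z}^2}}\mathrm{sg}(x)\,q^{(N+2)x^2-Ny^2}.$$ Then for every $\tau$ the sum for $c_{51}^{33}$ (that is, $N=6$, $\ell=3$, $m=1$) converges absolutely, $$c_{51}^{33}(\tau)=\frac{q^{1/3}}{J_1^3}\,f_{4,4,1}(q^4,q^3,q),\qquad \tfrac13=-\tfrac18+\tfrac{(\ell+1)^2}{4(N+2)}-\tfrac{m^2}{4N},$$ and $$c_{51}^{33}(\tau)=\eta(\tau)^{-3}\eta(2\tau)\eta(3\tau)\eta(6\tau)^{-1}\eta(12\tau).$$ -/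

import Mathlib

noncomputable section

namespace StringFn

/-- The theta function `j(x; q) = ∑_{n ∈ ℤ} (-1)^n q^{n(n-1)/2} x^n`. -/
def theta (x q : ℂ) : ℂ :=
  ∑' n : ℤ, (-1 : ℂ) ^ n * q ^ (n * (n - 1) / 2) * x ^ n

/-- `J_{a,m} = j(q^a; q^m)`. -/
def thetaJ (a m : ℤ) (q : ℂ) : ℂ := theta (q ^ a) (q ^ m)

/-- `J_m = J_{m,3m}`. -/
def eulerJ (m : ℤ) (q : ℂ) : ℂ := thetaJ m (3 * m) q

/-- The term of index `(r, s)` of the Hecke-type double sum, with its sign: the summand counts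
positively on `r, s ≥ 0`, negatively on `r, s < 0`, and is absent elsewhere. -/
def heckeTerm (a b c : ℤ) (x y q : ℂ) (p : ℤ × ℤ) : ℂ :=
  (if 0 ≤ p.1 ∧ 0 ≤ p.2 then 1 else if p.1 < 0 ∧ p.2 < 0 then -1 else 0) *
    ((-1 : ℂ) ^ (p.1 + p.2) * x ^ p.1 * y ^ p.2 *
      q ^ (a * (p.1 * (p.1 - 1) / 2) + b * p.1 * p.2 + c * (p.2 * (p.2 - 1) / 2)))

/-- The Hecke-type double sum `f_{a,b,c}(x, y, q)`. -/
def heckeF (a b c : ℤ) (x y q : ℂ) : ℂ := ∑' p : ℤ × ℤ, heckeTerm a b c x y q p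

/-- `q^x = e^{2πi x τ}` for a real exponent `x`, where `q = e^{2πiτ}`. -/
def qPow (τ : UpperHalfPlane) (x : ℝ) : ℂ :=
  Complex.exp (2 * Real.pi * Complex.I * (x : ℂ) * (τ : ℂ))

/-- The translated lattice `((ℓ+1)/(2(N+2)), m/(2N)) + ℤ²`. -/
def shiftedLattice (N l m : ℤ) : Set (ℝ × ℝ) :=
  {p | ∃ i k : ℤ, p = (((l : ℝ) + 1) / (2 * ((N : ℝ) + 2)) + i, (m : ℝ) / (2 * (N : ℝ)) + k)}

/-- The index set of the Kac–Peterson double sum for the string function of level `N`. -/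
def stringIndex (N l m : ℤ) : Set (ℝ × ℝ) :=
  {p | -|p.1| < p.2 ∧ p.2 ≤ |p.1| ∧
    (p ∈ shiftedLattice N l m ∨ (1 / 2 - p.1, 1 / 2 + p.2) ∈ shiftedLattice N l m)}

/-- The term `sg(x) q^{(N+2)x² - N y²}` of the Kac–Peterson double sum. -/
def stringTerm (N : ℤ) (τ : UpperHalfPlane) (p : ℝ × ℝ) : ℂ :=
  (if 0 ≤ p.1 then 1 else -1) * qPow τ (((N : ℝ) + 2) * p.1 ^ 2 - (N : ℝ) * p.2 ^ 2)

/-- The string function `c^{N-ℓ,ℓ}_{N-m,m}(τ)` of level `N` of the affine algebra `A₁⁽¹⁾`,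
in the Kac–Peterson form of an indefinite double sum divided by `η(τ)³`. -/
def stringFunction (N l m : ℤ) (τ : UpperHalfPlane) : ℂ :=
  (ModularForm.eta (τ : ℂ) ^ 3)⁻¹ * ∑' p : stringIndex N l m, stringTerm N τ p

/-- `s(m, ℓ, N) = -1/8 + (ℓ+1)²/(4(N+2)) - m²/(4N)`. -/
def sExponent (m l N : ℤ) : ℝ :=
  -(1 / 8) + ((l : ℝ) + 1) ^ 2 / (4 * ((N : ℝ) + 2)) - (m : ℝ) ^ 2 / (4 * (N : ℝ))

end StringFn

end

/-!
Summing the double sum over `s` first gives partial theta functions: since `j(q^n; q) = 0`, the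
halves `s ≥ 0` and `s < 0` contribute the same value `b_n = ∑_{s ≥ 0} (-1)^s q^{s(s-1)/2} q^{ns}`,
and `f = -∑_l (-1)^l (q⁴)^{l(l-1)/2} b_{4l-1}`. Write `t_n = (-1)^n q^{n(n-1)/2}`. The recursion
`b_n = 1 - q^n b_{n+1}` says `t_n b_n - t_{n+1} b_{n+1} = t_n`, so `∑ t_n b_n x^n` is
`j(x; q) / (1 - x⁻¹)`, an infinite product by the Jacobi triple product identity. At `x = q^{-k}` it
vanishes unless `k = 0`, so that `∑_n t_n b_{n+k}` is `-φ(q)³` for `k = 0` and zero otherwise. The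
identity `j(x; q) j(-x; q) = j(q; q²) j(x²; q²)`, applied twice, passes from the weights
`(q⁴)^{l(l-1)/2}` down to `q^{n(n-1)/2}` and yields
`j(q; q²) j(q²; q⁴) f = φ(q)³ j(-q; q⁶)`; what remains is an identity between infinite products.

For the string function, the index set consists of the points `(X/4, Y/12)` with `X ≡ 1 mod 4` and
`Y ≡ 1 mod 6` in the cone, and `X = (-1)^{r+s} (2(r+s)+1)`, `Y = 1 - 6s` turns its sum into `f`.
-/

noncomputable section

namespace StringFn

open Filter Topology

variable {q x : ℂ}

/-! ### Coefficients of the theta series -/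

/-- The binomial coefficient `n(n-1)/2` of an integer `n`, the exponent of `q` in the theta
series. -/
def tri (n : ℤ) : ℤ := n * (n - 1) / 2

theorem two_mul_tri (n : ℤ) : 2 * tri n = n * (n - 1) :=
  Int.mul_ediv_cancel' (Int.even_mul_pred_self n).two_dvd

theorem tri_add (m n : ℤ) : tri (m + n) = tri m + tri n + m * n := by
  linarith [two_mul_tri m, two_mul_tri n, two_mul_tri (m + n)]

theorem tri_two_mul (n : ℤ) : tri (2 * n) = 4 * tri n + n := by
  linarith [two_mul_tri n, two_mul_tri (2 * n)]

/-- The coefficient `(-1)^n q^{n(n-1)/2}` of `x^n` in the theta function `j(x; q)`. -/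
def thetaCoeff (q : ℂ) (n : ℤ) : ℂ := (-1) ^ n * q ^ tri n

theorem theta_eq_tsum (x q : ℂ) : theta x q = ∑' n, thetaCoeff q n * x ^ n := rfl

theorem thetaCoeff_zero (q : ℂ) : thetaCoeff q 0 = 1 := by simp [thetaCoeff, tri]

theorem thetaCoeff_one (q : ℂ) : thetaCoeff q 1 = -1 := by simp [thetaCoeff, tri]

theorem thetaCoeff_add (hq0 : q ≠ 0) (m n : ℤ) :
    thetaCoeff q (m + n) = thetaCoeff q m * thetaCoeff q n * q ^ (m * n) := by
  simp only [thetaCoeff, tri_add, zpow_add₀ hq0, zpow_add₀ (by norm_num : (-1 : ℂ) ≠ 0)]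
  ring

theorem thetaCoeff_add_one (hq0 : q ≠ 0) (n : ℤ) :
    thetaCoeff q (n + 1) = -q ^ n * thetaCoeff q n := by
  rw [thetaCoeff_add hq0, thetaCoeff_one, mul_one]
  ring

theorem thetaCoeff_neg (hq0 : q ≠ 0) (n : ℤ) : thetaCoeff q (-n) = q ^ n * thetaCoeff q n := by
  have htri : tri (-n) = n + tri n := by linarith [two_mul_tri n, two_mul_tri (-n)]
  rw [thetaCoeff, thetaCoeff, htri, zpow_add₀ hq0, ← inv_zpow', inv_neg_one]
  ring

theorem norm_thetaCoeff (q : ℂ) (n : ℤ) : ‖thetaCoeff q n‖ = ‖q‖ ^ tri n := by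
  simp [thetaCoeff, norm_zpow]

theorem thetaCoeff_ne_zero (hq0 : q ≠ 0) (n : ℤ) : thetaCoeff q n ≠ 0 := by
  simp [thetaCoeff, zpow_ne_zero, hq0]

theorem summable_norm_thetaCoeff_mul_pow (hq0 : q ≠ 0) (hq : ‖q‖ < 1) (hx : x ≠ 0) :
    Summable fun n : ℕ => ‖thetaCoeff q n * x ^ n‖ := by
  have hratio : Tendsto (fun n : ℕ => ‖q‖ ^ n * ‖x‖) atTop (𝓝 0) := by
    simpa using (tendsto_pow_atTop_nhds_zero_of_lt_one (norm_nonneg q) hq).mul_const ‖x‖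
  refine summable_of_ratio_test_tendsto_lt_one zero_lt_one
    (.of_forall fun n => by simp [thetaCoeff_ne_zero hq0, hx]) (hratio.congr fun n => ?_)
  have hc : ‖thetaCoeff q n‖ ≠ 0 := norm_ne_zero_iff.mpr (thetaCoeff_ne_zero hq0 n)
  rw [Nat.cast_add_one, thetaCoeff_add_one hq0]
  simp only [norm_norm, norm_mul, norm_neg, norm_pow, zpow_natCast]
  field_simp
  ring

theorem summable_norm_thetaCoeff_mul_zpow (hq0 : q ≠ 0) (hq : ‖q‖ < 1) (hx : x ≠ 0) :
    Summable fun n : ℤ => ‖thetaCoeff q n * x ^ n‖ := by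
  refine .of_nat_of_neg (by simpa using summable_norm_thetaCoeff_mul_pow hq0 hq hx) ?_
  refine (summable_norm_thetaCoeff_mul_pow hq0 hq (div_ne_zero hq0 hx)).congr fun n => ?_
  rw [thetaCoeff_neg hq0, zpow_neg, zpow_natCast, zpow_natCast, div_pow]
  congr 1
  ring

theorem summable_norm_thetaCoeff (hq0 : q ≠ 0) (hq : ‖q‖ < 1) :
    Summable fun n : ℤ => ‖thetaCoeff q n‖ := by
  simpa using summable_norm_thetaCoeff_mul_zpow hq0 hq one_ne_zero

theorem summable_norm_mul_of_norm_le {ι : Type*} {f c : ι → ℂ} {M : ℝ}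
    (hf : Summable fun i => ‖f i‖) (hc : ∀ i, ‖c i‖ ≤ M) : Summable fun i => ‖f i * c i‖ := by
  refine (hf.mul_right M).of_nonneg_of_le (fun i => norm_nonneg _) fun i => ?_
  rw [norm_mul]
  exact mul_le_mul_of_nonneg_left (hc i) (norm_nonneg _)

theorem continuousAt_tsum_thetaCoeff_mul_zpow (hq0 : q ≠ 0) (hq : ‖q‖ < 1) (hx : x ≠ 0)
    {c : ℤ → ℂ} {M : ℝ} (hc : ∀ n, ‖c n‖ ≤ M) :
    ContinuousAt (fun y => ∑' n, thetaCoeff q n * c n * y ^ n) x := by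
  have hsum : ∀ {y : ℂ}, y ≠ 0 → Summable fun n => ‖thetaCoeff q n * y ^ n * c n‖ := fun hy =>
    summable_norm_mul_of_norm_le (summable_norm_thetaCoeff_mul_zpow hq0 hq hy) hc
  have hnorm : Tendsto (fun y : ℂ => ‖y‖) (𝓝 x) (𝓝 ‖x‖) := continuous_norm.tendsto x
  have hpos : 0 < ‖x‖ := norm_pos_iff.mpr hx
  refine tendsto_tsum_of_dominated_convergence
    ((hsum (mul_ne_zero two_ne_zero hx)).add (hsum (div_ne_zero hx two_ne_zero)))
    (fun n => ((continuousAt_zpow₀ x n (Or.inl hx)).tendsto).const_mul _) ?_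
  filter_upwards [hnorm.eventually_lt_const (by linarith : ‖x‖ < 2 * ‖x‖),
    hnorm.eventually_const_lt (by linarith : ‖x‖ / 2 < ‖x‖)] with y hupper hlower n
  have hzpow : ‖y‖ ^ n ≤ ‖2 * x‖ ^ n + ‖x / 2‖ ^ n := by
    rw [norm_mul, norm_div, Complex.norm_two]
    rcases le_total 0 n with hn | hn
    · exact (zpow_le_zpow_left₀ hn (norm_nonneg y) hupper.le).trans
        (le_add_of_nonneg_right (by positivity))
    · have hinv := zpow_le_zpow_left₀ (neg_nonneg.mpr hn) (by positivity)
        (inv_anti₀ (half_pos hpos) hlower.le)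
      simp only [inv_zpow', neg_neg] at hinv
      exact hinv.trans (le_add_of_nonneg_left (by positivity))
  calc ‖thetaCoeff q n * c n * y ^ n‖ = ‖thetaCoeff q n * c n‖ * ‖y‖ ^ n := by
        rw [norm_mul, norm_zpow]
    _ ≤ ‖thetaCoeff q n * c n‖ * (‖2 * x‖ ^ n + ‖x / 2‖ ^ n) := by gcongr
    _ = ‖thetaCoeff q n * (2 * x) ^ n * c n‖ + ‖thetaCoeff q n * (x / 2) ^ n * c n‖ := by
        simp only [norm_mul, norm_zpow]
        ring

/-! ### Infinite products -/

/-- The infinite `q`-shifted factorial `(x; q)_∞ = ∏_{n ≥ 0} (1 - x q^n)`. -/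
def qPochhammer (x q : ℂ) : ℂ := ∏' n : ℕ, (1 - x * q ^ n)

/-- Euler's function `φ(q) = (q; q)_∞`, which the paper writes as `J_1`. -/
def eulerPhi (q : ℂ) : ℂ := qPochhammer q q

theorem norm_pow_lt_one (hq : ‖q‖ < 1) {k : ℕ} (hk : k ≠ 0) : ‖q ^ k‖ < 1 := by
  rw [norm_pow]
  exact pow_lt_one₀ (norm_nonneg q) hq hk

theorem summable_norm_mul_pow (x : ℂ) (hq : ‖q‖ < 1) :
    Summable fun n : ℕ => ‖-(x * q ^ n)‖ := by
  simpa using (summable_geometric_of_lt_one (norm_nonneg _) hq).mul_left ‖x‖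

theorem multipliable_one_sub_mul_pow (x : ℂ) (hq : ‖q‖ < 1) :
    Multipliable fun n : ℕ => 1 - x * q ^ n := by
  simpa [sub_eq_add_neg] using multipliable_one_add_of_summable (summable_norm_mul_pow x hq)

theorem qPochhammer_zero (q : ℂ) : qPochhammer 0 q = 1 := by simp [qPochhammer]

theorem one_sub_pow_succ_ne_zero (hq : ‖q‖ < 1) (n : ℕ) : 1 - q ^ (n + 1) ≠ 0 := by
  have hpow := norm_pow_lt_one hq n.succ_ne_zero
  intro h
  simp [← sub_eq_zero.mp h] at hpow

theorem eulerPhi_ne_zero (hq : ‖q‖ < 1) : eulerPhi q ≠ 0 := by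
  have hfactor : ∀ n : ℕ, 1 + -(q * q ^ n) ≠ 0 := fun n => by
    simpa [pow_succ', sub_eq_add_neg] using one_sub_pow_succ_ne_zero hq n
  simpa [eulerPhi, qPochhammer, sub_eq_add_neg] using
    tprod_one_add_ne_zero_of_summable hfactor (summable_norm_mul_pow q hq)

theorem qPochhammer_eq_mul (x : ℂ) (hq : ‖q‖ < 1) :
    qPochhammer x q = (1 - x) * qPochhammer (x * q) q := by
  rw [qPochhammer, tprod_eq_zero_mul' ?_]
  · simp [qPochhammer, pow_succ', mul_assoc]
  · simpa [pow_succ', mul_assoc] using multipliable_one_sub_mul_pow (x * q) hq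

theorem qPochhammer_zpow_eq_mul (hq0 : q ≠ 0) (hq : ‖q‖ < 1) (n : ℤ) :
    qPochhammer (q ^ n) q = (1 - q ^ n) * qPochhammer (q ^ (n + 1)) q := by
  rw [qPochhammer_eq_mul _ hq, zpow_add_one₀ hq0]

theorem qPochhammer_zpow_eq_zero (hq0 : q ≠ 0) {n : ℤ} (hn : n ≤ 0) :
    qPochhammer (q ^ n) q = 0 := by
  refine tprod_of_exists_eq_zero ⟨n.natAbs, ?_⟩
  rw [← zpow_natCast, ← zpow_add₀ hq0, Int.ofNat_natAbs_of_nonpos hn, add_neg_cancel, zpow_zero,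
    sub_self]

theorem continuous_qPochhammer (hq : ‖q‖ < 1) : Continuous fun x => qPochhammer x q := by
  refine continuous_iff_continuousAt.mpr fun x => ?_
  have hnear : ∀ᶠ y in 𝓝 x, ‖y‖ < ‖x‖ + 1 :=
    (continuous_norm.tendsto x).eventually_lt_const (lt_add_one _)
  have hlim : Tendsto (fun y => ∏' n : ℕ, (1 + -(y * q ^ n))) (𝓝 x)
      (𝓝 (∏' n : ℕ, (1 + -(x * q ^ n)))) := by
    refine tendsto_tprod_one_add_of_dominated_convergence
      ((summable_geometric_of_lt_one (norm_nonneg q) hq).mul_left (‖x‖ + 1))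
      (fun n => (by fun_prop : Continuous fun y => -(y * q ^ n)).tendsto x) ?_
    filter_upwards [hnear] with y hy n
    rw [norm_neg, norm_mul, norm_pow]
    gcongr
  simpa only [ContinuousAt, qPochhammer, sub_eq_add_neg] using hlim

theorem exists_norm_qPochhammer_zpow_le (hq0 : q ≠ 0) (hq : ‖q‖ < 1) :
    ∃ C, ∀ n : ℤ, ‖qPochhammer (q ^ n) q‖ ≤ C := by
  obtain ⟨C, hC⟩ := (isCompact_closedBall (0 : ℂ) 1).exists_bound_of_continuousOn
    (continuous_qPochhammer hq).continuousOn
  refine ⟨C, fun n => ?_⟩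
  rcases le_total n 0 with hn | hn
  · rw [qPochhammer_zpow_eq_zero hq0 hn, norm_zero]
    exact (norm_nonneg _).trans (hC 0 (by simp))
  · refine hC _ ?_
    rw [mem_closedBall_zero_iff, norm_zpow]
    exact zpow_le_one₀ (norm_pos_iff.mpr hq0) hq.le hn

theorem tendsto_qPochhammer_zpow_add (hq0 : q ≠ 0) (hq : ‖q‖ < 1) (k : ℤ) :
    Tendsto (fun n : ℕ => qPochhammer (q ^ (n + k)) q) atTop (𝓝 1) := by
  have hpow : Tendsto (fun n : ℕ => q ^ (n + k)) atTop (𝓝 0) := by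
    simpa [zpow_add₀ hq0] using (tendsto_pow_atTop_nhds_zero_of_norm_lt_one hq).mul_const (q ^ k)
  have hcont := (continuous_qPochhammer hq).tendsto 0
  rw [qPochhammer_zero] at hcont
  exact hcont.comp hpow

theorem tendsto_prod_one_sub_mul_pow (x : ℂ) (hq : ‖q‖ < 1) :
    Tendsto (fun n => ∏ i ∈ Finset.range n, (1 - x * q ^ i)) atTop (𝓝 (qPochhammer x q)) :=
  (multipliable_one_sub_mul_pow x hq).hasProd.tendsto_prod_nat

theorem qPochhammer_eq_prod (k : ℕ) [NeZero k] (x : ℂ) (hq : ‖q‖ < 1) :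
    qPochhammer x q = ∏ j : Fin k, qPochhammer (x * q ^ (j : ℕ)) (q ^ k) := by
  have hqk : ‖q ^ k‖ < 1 := norm_pow_lt_one hq (NeZero.ne k)
  have hresidues := (((Nat.divModEquiv k).trans (Equiv.prodComm _ _)).symm.hasProd_iff).mpr
    (multipliable_one_sub_mul_pow x hq).hasProd
  have hfibers := hresidues.prod_fiberwise
    (g := fun j : Fin k => qPochhammer (x * q ^ (j : ℕ)) (q ^ k)) (fun j => by
      convert! (multipliable_one_sub_mul_pow (x * q ^ (j : ℕ)) hqk).hasProd using 2 with n
      simp only [Nat.divModEquiv, Equiv.symm_trans, Equiv.prodComm_symm, Equiv.symm_mk,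
        Equiv.coe_trans, Equiv.coe_fn_mk, Equiv.coe_prodComm, Function.comp_apply,
        Prod.swap_prod_mk]
      ring)
  rw [qPochhammer, ← hfibers.tprod_eq, tprod_fintype]

theorem qPochhammer_neg_mul_qPochhammer (x : ℂ) (hq : ‖q‖ < 1) :
    qPochhammer (-x) q * qPochhammer x q = qPochhammer (x ^ 2) (q ^ 2) := by
  rw [qPochhammer, qPochhammer, ← (multipliable_one_sub_mul_pow _ hq).tprod_mul
    (multipliable_one_sub_mul_pow _ hq), qPochhammer]
  exact tprod_congr fun n => by ring

/-! ### The Jacobi triple product -/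

/-- The terms of a finite form of the Jacobi triple product identity. The product
`(q^{n+j+1}; q)_∞ (q^{n-j+1}; q)_∞` vanishes for `|j| > n` and is a multiple of the Gaussian
binomial coefficient `[2n, n+j]_q` otherwise. -/
def tripleTerm (x q : ℂ) (n : ℕ) (j : ℤ) : ℂ :=
  thetaCoeff q j * x ^ j * (qPochhammer (q ^ (n + j + 1)) q * qPochhammer (q ^ (n - j + 1)) q)

theorem tripleTerm_zero_eq_zero (hq0 : q ≠ 0) {j : ℤ} (hj : j ≠ 0) : tripleTerm x q 0 j = 0 := by
  rcases hj.lt_or_gt with hj | hj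
  · simp [tripleTerm, qPochhammer_zpow_eq_zero hq0 (by omega : j + 1 ≤ 0)]
  · simp [tripleTerm, qPochhammer_zpow_eq_zero hq0 (by omega : -j + 1 ≤ 0)]

theorem tsum_tripleTerm_zero (hq0 : q ≠ 0) : ∑' j, tripleTerm x q 0 j = eulerPhi q ^ 2 := by
  rw [tsum_eq_single 0 fun j hj => tripleTerm_zero_eq_zero hq0 hj]
  simp [tripleTerm, thetaCoeff_zero, eulerPhi, sq]

theorem exists_norm_tripleTerm_le (x : ℂ) (hq0 : q ≠ 0) (hq : ‖q‖ < 1) :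
    ∃ C, ∀ n j, ‖tripleTerm x q n j‖ ≤ ‖thetaCoeff q j * x ^ j‖ * C := by
  obtain ⟨C, hC⟩ := exists_norm_qPochhammer_zpow_le hq0 hq
  refine ⟨C * C, fun n j => ?_⟩
  rw [tripleTerm, norm_mul, norm_mul (qPochhammer _ _)]
  gcongr
  · exact (norm_nonneg _).trans (hC 0)
  · exact hC _
  · exact hC _

theorem summable_tripleTerm (hq0 : q ≠ 0) (hq : ‖q‖ < 1) (hx : x ≠ 0) (n : ℕ) :
    Summable (tripleTerm x q n) := by
  obtain ⟨C, hC⟩ := exists_norm_tripleTerm_le x hq0 hq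
  exact .of_norm_bounded ((summable_norm_thetaCoeff_mul_zpow hq0 hq hx).mul_right C) (hC n)

theorem tripleTerm_succ (hq0 : q ≠ 0) (hq : ‖q‖ < 1) (hx : x ≠ 0) (n : ℕ) (j : ℤ) :
    (1 - q ^ (2 * n + 1)) * (1 - q ^ (2 * n + 2)) * tripleTerm x q (n + 1) j =
      (1 + q ^ (2 * n + 1)) * tripleTerm x q n j - x * q ^ n * tripleTerm x q n (j - 1) -
        q ^ (n + 1) / x * tripleTerm x q n (j + 1) := by
  have hcoeff : thetaCoeff q j = -q ^ (j - 1) * thetaCoeff q (j - 1) := by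
    simpa using thetaCoeff_add_one hq0 (j - 1)
  have hA := qPochhammer_zpow_eq_mul hq0 hq (n + j + 1)
  have hA' := qPochhammer_zpow_eq_mul hq0 hq (n + j)
  have hB := qPochhammer_zpow_eq_mul hq0 hq (n - j + 1)
  have hB' := qPochhammer_zpow_eq_mul hq0 hq (n - j)
  simp only [tripleTerm, thetaCoeff_add_one hq0 j, hcoeff]
  rw [show (n + (j - 1) + 1 : ℤ) = n + j by ring,
    show (n - (j - 1) + 1 : ℤ) = n - j + 1 + 1 by ring,
    show (n + (j + 1) + 1 : ℤ) = n + j + 1 + 1 by ring, show (n - (j + 1) + 1 : ℤ) = n - j by ring,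
    show ((n + 1 : ℕ) + j + 1 : ℤ) = n + j + 1 + 1 by push_cast; ring,
    show ((n + 1 : ℕ) - j + 1 : ℤ) = n - j + 1 + 1 by push_cast; ring, hA', hA, hB', hB]
  generalize qPochhammer (q ^ (n + j + 1 + 1 : ℤ)) q = A
  generalize qPochhammer (q ^ (n - j + 1 + 1 : ℤ)) q = B
  simp only [zpow_add₀ hq0, zpow_sub₀ hq0, zpow_add₀ hx, zpow_sub₀ hx, zpow_one, zpow_natCast]
  have hqj : q ^ j ≠ 0 := zpow_ne_zero _ hq0
  have hxj : x ^ j ≠ 0 := zpow_ne_zero _ hx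
  field_simp
  ring

theorem tsum_tripleTerm_succ (hq0 : q ≠ 0) (hq : ‖q‖ < 1) (hx : x ≠ 0) (n : ℕ) :
    (1 - q ^ (2 * n + 1)) * (1 - q ^ (2 * n + 2)) * ∑' j, tripleTerm x q (n + 1) j =
      (1 - x * q ^ n) * (1 - q / x * q ^ n) * ∑' j, tripleTerm x q n j := by
  have hsum : HasSum (tripleTerm x q n) (∑' j, tripleTerm x q n j) :=
    (summable_tripleTerm hq0 hq hx n).hasSum
  have hpred : HasSum (fun j => tripleTerm x q n (j - 1)) (∑' j, tripleTerm x q n j) := by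
    simpa [Function.comp_def] using (Equiv.subRight (1 : ℤ)).hasSum_iff.mpr hsum
  have hsucc : HasSum (fun j => tripleTerm x q n (j + 1)) (∑' j, tripleTerm x q n j) := by
    simpa [Function.comp_def] using (Equiv.addRight (1 : ℤ)).hasSum_iff.mpr hsum
  have hrec := ((hsum.mul_left (1 + q ^ (2 * n + 1))).sub (hpred.mul_left (x * q ^ n))).sub
    (hsucc.mul_left (q ^ (n + 1) / x))
  rw [← tsum_mul_left, tsum_congr (tripleTerm_succ hq0 hq hx n), hrec.tsum_eq]
  field_simp
  ring

theorem tsum_tripleTerm (hq0 : q ≠ 0) (hq : ‖q‖ < 1) (hx : x ≠ 0) (n : ℕ) :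
    ∑' j, tripleTerm x q n j = eulerPhi q * qPochhammer (q ^ (2 * n + 1 : ℤ)) q *
      ((∏ i ∈ Finset.range n, (1 - x * q ^ i)) * ∏ i ∈ Finset.range n, (1 - q / x * q ^ i)) := by
  induction n with
  | zero => simp [tsum_tripleTerm_zero hq0, eulerPhi, sq]
  | succ n ih =>
    have hstep : qPochhammer (q ^ (2 * n + 1 : ℤ)) q = (1 - q ^ (2 * n + 1)) *
        ((1 - q ^ (2 * n + 2)) * qPochhammer (q ^ (2 * (n + 1 : ℕ) + 1 : ℤ)) q) := by
      rw [qPochhammer_zpow_eq_mul hq0 hq, qPochhammer_zpow_eq_mul hq0 hq]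
      norm_cast
    refine mul_left_cancel₀ (mul_ne_zero (one_sub_pow_succ_ne_zero hq (2 * n))
      (one_sub_pow_succ_ne_zero hq (2 * n + 1))) ?_
    rw [tsum_tripleTerm_succ hq0 hq hx, ih, hstep, Finset.prod_range_succ, Finset.prod_range_succ]
    ring

theorem tendsto_tsum_tripleTerm (hq0 : q ≠ 0) (hq : ‖q‖ < 1) (hx : x ≠ 0) :
    Tendsto (fun n => ∑' j, tripleTerm x q n j) atTop (𝓝 (theta x q)) := by
  obtain ⟨C, hC⟩ := exists_norm_tripleTerm_le x hq0 hq
  rw [theta_eq_tsum]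
  refine tendsto_tsum_of_dominated_convergence
    ((summable_norm_thetaCoeff_mul_zpow hq0 hq hx).mul_right C) (fun j => ?_) (.of_forall hC)
  simpa [tripleTerm, add_assoc, sub_eq_add_neg] using
    ((tendsto_qPochhammer_zpow_add hq0 hq (j + 1)).mul
      (tendsto_qPochhammer_zpow_add hq0 hq (-j + 1))).const_mul (thetaCoeff q j * x ^ j)

theorem theta_eq_qPochhammer (hq0 : q ≠ 0) (hq : ‖q‖ < 1) (hx : x ≠ 0) :
    theta x q = eulerPhi q * qPochhammer x q * qPochhammer (q / x) q := by
  have htail : Tendsto (fun n : ℕ => qPochhammer (q ^ (2 * n + 1 : ℤ)) q) atTop (𝓝 1) := by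
    have hdouble : Tendsto (fun n : ℕ => 2 * n) atTop atTop :=
      tendsto_id.const_mul_atTop' zero_lt_two
    exact_mod_cast (tendsto_qPochhammer_zpow_add hq0 hq 1).comp hdouble
  have hlim := (htail.const_mul (eulerPhi q)).mul
    ((tendsto_prod_one_sub_mul_pow x hq).mul (tendsto_prod_one_sub_mul_pow (q / x) hq))
  rw [tendsto_nhds_unique (tendsto_tsum_tripleTerm hq0 hq hx)
    (hlim.congr fun n => (tsum_tripleTerm hq0 hq hx n).symm)]
  ring

theorem theta_zpow_eq_zero (hq0 : q ≠ 0) (hq : ‖q‖ < 1) (n : ℤ) : theta (q ^ n) q = 0 := by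
  rw [theta_eq_qPochhammer hq0 hq (zpow_ne_zero n hq0)]
  rcases le_or_gt n 0 with hn | hn
  · simp [qPochhammer_zpow_eq_zero hq0 hn]
  · rw [show q / q ^ n = q ^ (1 - n) by rw [zpow_sub₀ hq0, zpow_one],
      qPochhammer_zpow_eq_zero hq0 (by omega : 1 - n ≤ 0), mul_zero]

/-! ### Partial theta functions -/

/-- The partial theta function, the half `∑_{n ≥ 0} (-1)^n q^{n(n-1)/2} x^n` of the theta
series. -/
def partialTheta (x q : ℂ) : ℂ := ∑' n : ℕ, thetaCoeff q n * x ^ n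

theorem partialTheta_eq_one_sub (hq0 : q ≠ 0) (hq : ‖q‖ < 1) (hx : x ≠ 0) :
    partialTheta x q = 1 - x * partialTheta (x * q) q := by
  have hterm : ∀ n : ℕ, thetaCoeff q (n + 1 : ℕ) * x ^ (n + 1) =
      -x * (thetaCoeff q n * (x * q) ^ n) := fun n => by
    rw [Nat.cast_add_one, thetaCoeff_add_one hq0, zpow_natCast]
    ring
  rw [partialTheta, (summable_norm_thetaCoeff_mul_pow hq0 hq hx).of_norm.tsum_eq_zero_add,
    tsum_congr hterm, tsum_mul_left, partialTheta, Nat.cast_zero, thetaCoeff_zero]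
  ring

theorem hasSum_partialTheta (hq0 : q ≠ 0) (hq : ‖q‖ < 1) (hx : x ≠ 0) :
    HasSum (fun n : ℕ => thetaCoeff q n * x ^ (n : ℤ)) (partialTheta x q) := by
  simp only [zpow_natCast]
  exact (summable_norm_thetaCoeff_mul_pow hq0 hq hx).of_norm.hasSum

theorem neg_natCast_add_one_injective : Function.Injective fun n : ℕ => (-(n + 1) : ℤ) :=
  fun m n h => by simpa using h

theorem hasSum_neg_partialTheta (hq0 : q ≠ 0) (hq : ‖q‖ < 1) (hx : x ≠ 0)
    (hzero : theta x q = 0) :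
    HasSum (fun n : ℕ => thetaCoeff q (-(n + 1)) * x ^ (-(n + 1 : ℤ))) (-partialTheta x q) := by
  have hsum := (summable_norm_thetaCoeff_mul_zpow hq0 hq hx).of_norm
  have hneg : Summable fun n : ℕ => thetaCoeff q (-(n + 1)) * x ^ (-(n + 1 : ℤ)) := by
    simpa only [Function.comp_def] using hsum.comp_injective neg_natCast_add_one_injective
  have htotal := (HasSum.of_nat_of_neg_add_one (f := fun n => thetaCoeff q n * x ^ n)
    (hasSum_partialTheta hq0 hq hx) hneg.hasSum).tsum_eq
  rw [← theta_eq_tsum, hzero] at htotal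
  rw [← eq_neg_of_add_eq_zero_right htotal.symm]
  exact hneg.hasSum

theorem exists_norm_partialTheta_zpow_le (hq0 : q ≠ 0) (hq : ‖q‖ < 1) :
    ∃ M, ∀ n : ℤ, ‖partialTheta (q ^ n) q‖ ≤ M := by
  have hsum := summable_norm_thetaCoeff hq0 hq
  have hbound : ∀ {m n : ℤ}, 0 ≤ n * m → ‖thetaCoeff q m * (q ^ n) ^ m‖ ≤ ‖thetaCoeff q m‖ :=
    fun {m n} h => by
      rw [norm_mul, ← zpow_mul, norm_zpow]
      exact mul_le_of_le_one_right (norm_nonneg _) (zpow_le_one₀ (norm_pos_iff.mpr hq0) hq.le h)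
  refine ⟨∑' m, ‖thetaCoeff q m‖, fun n => ?_⟩
  have hqn : q ^ n ≠ 0 := zpow_ne_zero n hq0
  rcases le_total 0 n with hn | hn
  · rw [← (hasSum_partialTheta hq0 hq hqn).tsum_eq]
    have hcast : Function.Injective fun m : ℕ => (m : ℤ) := Nat.cast_injective
    exact (tsum_of_norm_bounded (hsum.comp_injective hcast).hasSum fun m =>
      hbound (by positivity)).trans (tsum_comp_le_tsum_of_inj hsum (fun _ => norm_nonneg _) hcast)
  · rw [← norm_neg, ← (hasSum_neg_partialTheta hq0 hq hqn (theta_zpow_eq_zero hq0 hq n)).tsum_eq]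
    exact (tsum_of_norm_bounded (hsum.comp_injective neg_natCast_add_one_injective).hasSum
      fun m => hbound (mul_nonneg_of_nonpos_of_nonpos hn (by omega))).trans
        (tsum_comp_le_tsum_of_inj hsum (fun _ => norm_nonneg _) neg_natCast_add_one_injective)

theorem thetaCoeff_mul_partialTheta_sub (hq0 : q ≠ 0) (hq : ‖q‖ < 1) (n : ℤ) :
    thetaCoeff q n * partialTheta (q ^ n) q -
      thetaCoeff q (n + 1) * partialTheta (q ^ (n + 1)) q = thetaCoeff q n := by
  rw [partialTheta_eq_one_sub hq0 hq (zpow_ne_zero n hq0), ← zpow_add_one₀ hq0,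
    thetaCoeff_add_one hq0]
  ring

theorem theta_eq_mul_tsum_partialTheta (hq0 : q ≠ 0) (hq : ‖q‖ < 1) (hx : x ≠ 0) :
    theta x q = (1 - x⁻¹) * ∑' n : ℤ, thetaCoeff q n * partialTheta (q ^ n) q * x ^ n := by
  obtain ⟨M, hM⟩ := exists_norm_partialTheta_zpow_le hq0 hq
  have hsummable : Summable fun n : ℤ => thetaCoeff q n * partialTheta (q ^ n) q * x ^ n := by
    simpa only [mul_right_comm] using (summable_norm_mul_of_norm_le
      (summable_norm_thetaCoeff_mul_zpow hq0 hq hx) hM).of_norm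
  have hsum := hsummable.hasSum
  have hsucc := ((Equiv.addRight (1 : ℤ)).hasSum_iff.mpr hsum).mul_left x⁻¹
  rw [theta_eq_tsum, sub_mul, one_mul, ← (hsum.sub hsucc).tsum_eq]
  refine tsum_congr fun n => ?_
  simp only [Function.comp_apply, Equiv.coe_addRight, zpow_add_one₀ hx]
  field_simp
  exact (thetaCoeff_mul_partialTheta_sub hq0 hq n).symm

-- Away from `x = 1` this is the previous identity divided by `1 - x⁻¹`; continuity gives `x = 1`.
theorem tsum_thetaCoeff_mul_partialTheta (hq0 : q ≠ 0) (hq : ‖q‖ < 1) (hx : x ≠ 0) :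
    ∑' n : ℤ, thetaCoeff q n * partialTheta (q ^ n) q * x ^ n =
      -x * (eulerPhi q * qPochhammer (x * q) q * qPochhammer (q / x) q) := by
  have hgeneric : ∀ {y : ℂ}, y ≠ 0 → y ≠ 1 →
      ∑' n : ℤ, thetaCoeff q n * partialTheta (q ^ n) q * y ^ n =
        -y * (eulerPhi q * qPochhammer (y * q) q * qPochhammer (q / y) q) := fun {y} hy hy1 => by
    have hsub : y - 1 ≠ 0 := sub_ne_zero.mpr hy1
    have htheta := theta_eq_mul_tsum_partialTheta hq0 hq hy
    rw [theta_eq_qPochhammer hq0 hq hy, qPochhammer_eq_mul y hq] at htheta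
    field_simp at htheta
    refine mul_left_cancel₀ hsub ?_
    linear_combination -htheta
  rcases eq_or_ne x 1 with rfl | hx1
  · obtain ⟨M, hM⟩ := exists_norm_partialTheta_zpow_le hq0 hq
    have hleft := continuousAt_tsum_thetaCoeff_mul_zpow hq0 hq hx hM
    have hright : ContinuousAt
        (fun y => -y * (eulerPhi q * qPochhammer (y * q) q * qPochhammer (q / y) q)) 1 := by
      have hpoch := continuous_qPochhammer hq
      have hdiv : ContinuousAt (fun y : ℂ => q / y) 1 := continuousAt_const.div continuousAt_id hx
      exact continuousAt_id.neg.mul ((continuousAt_const.mul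
        (by fun_prop : Continuous fun y => qPochhammer (y * q) q).continuousAt).mul
          (hpoch.continuousAt.comp hdiv))
    refine (hleft.eventuallyEq_nhds_iff_eventuallyEq_nhdsNE hright).mp ?_ |>.eq_of_nhds
    filter_upwards [self_mem_nhdsWithin, nhdsWithin_le_nhds (eventually_ne_nhds hx)] with y h1 h0
    exact hgeneric h0 h1
  · exact hgeneric hx hx1

theorem tsum_thetaCoeff_mul_partialTheta_add (hq0 : q ≠ 0) (hq : ‖q‖ < 1) (k : ℤ) :
    ∑' n, thetaCoeff q n * partialTheta (q ^ (n + k)) q =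
      if k = 0 then -eulerPhi q ^ 3 else 0 := by
  have hterm : ∀ n, thetaCoeff q (n - k) * partialTheta (q ^ (n - k + k)) q =
      thetaCoeff q (-k) * (thetaCoeff q n * partialTheta (q ^ n) q * (q ^ (-k)) ^ n) := fun n => by
    rw [sub_add_cancel, sub_eq_add_neg, thetaCoeff_add hq0, mul_comm n (-k), zpow_mul]
    ring
  rw [← (Equiv.subRight k).tsum_eq]
  simp only [Equiv.subRight_apply, hterm]
  rw [tsum_mul_left, tsum_thetaCoeff_mul_partialTheta hq0 hq (zpow_ne_zero _ hq0)]
  split_ifs with hk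
  · subst hk
    simp only [neg_zero, thetaCoeff_zero, zpow_zero, one_mul, div_one, eulerPhi]
    ring
  · rcases lt_or_gt_of_ne hk with hk | hk
    · rw [show q / q ^ (-k) = q ^ (1 + k) by rw [zpow_neg, div_inv_eq_mul, zpow_one_add₀ hq0],
        qPochhammer_zpow_eq_zero hq0 (by omega : 1 + k ≤ 0)]
      ring
    · rw [← zpow_add_one₀ hq0, qPochhammer_zpow_eq_zero hq0 (by omega : -k + 1 ≤ 0)]
      ring

/-! ### Products of two theta series -/

theorem zpow_sq_tri (q : ℂ) (n : ℤ) : (q ^ 2) ^ tri n = q ^ (2 * tri n) := by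
  rw [zpow_mul, zpow_ofNat]

theorem tsum_thetaCoeff_mul_zpow_tri_even (hq0 : q ≠ 0) (l : ℤ) :
    ∑' n, thetaCoeff q n * q ^ tri (2 * l - n) = thetaCoeff (q ^ 2) l * theta q (q ^ 2) := by
  rw [← (Equiv.addLeft l).tsum_eq, theta_eq_tsum, ← tsum_mul_left]
  refine tsum_congr fun n => ?_
  have htri : tri (l + n) + tri (2 * l - (l + n)) = 2 * tri l + (2 * tri n + n) := by
    linarith [two_mul_tri (l + n), two_mul_tri (2 * l - (l + n)), two_mul_tri l, two_mul_tri n]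
  rw [Equiv.coe_addLeft, thetaCoeff, thetaCoeff, thetaCoeff, mul_assoc, ← zpow_add₀ hq0, htri,
    zpow_add₀ hq0, zpow_add₀ hq0, zpow_add₀ (by norm_num), zpow_sq_tri, zpow_sq_tri]
  ring

theorem tsum_thetaCoeff_mul_zpow_tri_odd (q : ℂ) {k : ℤ} (hk : Odd k) :
    ∑' n, thetaCoeff q n * q ^ tri (k - n) = 0 := by
  have hanti : ∀ n, thetaCoeff q (k - n) * q ^ tri (k - (k - n)) =
      -(thetaCoeff q n * q ^ tri (k - n)) := fun n => by
    rw [thetaCoeff, thetaCoeff, sub_sub_cancel, zpow_sub₀ (by norm_num), hk.neg_one_zpow,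
      div_eq_mul_inv, ← inv_zpow, inv_neg_one]
    ring
  have hneg := (Equiv.subLeft k).tsum_eq fun n => thetaCoeff q n * q ^ tri (k - n)
  simp only [Equiv.subLeft_apply, hanti, tsum_neg] at hneg
  exact self_eq_neg.mp hneg.symm

theorem tsum_tsum_eq_tsum_tsum_sub {F : ℤ → ℤ → ℂ} (hF : Summable (Function.uncurry F)) :
    ∑' m, ∑' n, F n m = ∑' k, ∑' n, F n (k - n) := by
  let shear : ℤ × ℤ ≃ ℤ × ℤ := Equiv.prodShear (Equiv.refl ℤ) Equiv.subRight
  have hcomp : Function.uncurry F ∘ shear = Function.uncurry fun n k => F n (k - n) := rfl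
  have hshear : Summable (Function.uncurry fun n k => F n (k - n)) :=
    hcomp ▸ shear.summable_iff.mpr hF
  calc ∑' m, ∑' n, F n m = ∑' p, Function.uncurry F p := by rw [hF.tsum_comm, hF.tsum_prod]; rfl
    _ = ∑' p, Function.uncurry (fun n k => F n (k - n)) p := by
        rw [← hcomp]
        exact (shear.tsum_eq _).symm
    _ = ∑' k, ∑' n, F n (k - n) := by rw [hshear.tsum_comm, hshear.tsum_prod]; rfl

-- On coefficients, this is `j(x; q) j(-x; q) = j(q; q²) j(x²; q²)`.
theorem tsum_zpow_tri_mul_tsum_thetaCoeff (hq0 : q ≠ 0) (hq : ‖q‖ < 1) {c : ℤ → ℂ} {M : ℝ}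
    (hc : ∀ n, ‖c n‖ ≤ M) :
    ∑' m, q ^ tri m * ∑' n, thetaCoeff q n * c (n + m) =
      theta q (q ^ 2) * ∑' l, thetaCoeff (q ^ 2) l * c (2 * l) := by
  have hcoeff := summable_norm_thetaCoeff hq0 hq
  have htri : Summable fun m => ‖q ^ tri m‖ := hcoeff.congr fun m => by
    rw [norm_thetaCoeff, norm_zpow]
  have hF : Summable fun p : ℤ × ℤ => thetaCoeff q p.1 * q ^ tri p.2 * c (p.1 + p.2) :=
    (summable_norm_mul_of_norm_le (hcoeff.mul_norm htri) fun p => hc (p.1 + p.2)).of_norm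
  have hsupport : Function.support
      (fun k => (∑' n, thetaCoeff q n * q ^ tri (k - n)) * c k) ⊆ Set.range fun l => 2 * l := by
    intro k hk
    by_contra hodd
    refine hk ?_
    simp only
    rw [tsum_thetaCoeff_mul_zpow_tri_odd q, zero_mul]
    simpa [Set.mem_range, eq_comm, ← even_iff_exists_two_mul] using hodd
  calc ∑' m, q ^ tri m * ∑' n, thetaCoeff q n * c (n + m)
      = ∑' m, ∑' n, thetaCoeff q n * q ^ tri m * c (n + m) :=
        tsum_congr fun m => by rw [← tsum_mul_left]; exact tsum_congr fun n => by ring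
    _ = ∑' k, ∑' n, thetaCoeff q n * q ^ tri (k - n) * c (n + (k - n)) :=
        tsum_tsum_eq_tsum_tsum_sub hF
    _ = ∑' k, (∑' n, thetaCoeff q n * q ^ tri (k - n)) * c k :=
        tsum_congr fun k => by rw [← tsum_mul_right]; exact tsum_congr fun n => by ring_nf
    _ = ∑' l, (∑' n, thetaCoeff q n * q ^ tri (2 * l - n)) * c (2 * l) :=
        ((mul_right_injective₀ two_ne_zero).tsum_eq hsupport).symm
    _ = theta q (q ^ 2) * ∑' l, thetaCoeff (q ^ 2) l * c (2 * l) := by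
        rw [← tsum_mul_left]
        exact tsum_congr fun l => by rw [tsum_thetaCoeff_mul_zpow_tri_even hq0]; ring

/-! ### Hecke-type double sums -/

/-- The sign with which the pair `(r, s)` enters a Hecke-type double sum. -/
def quadrantSign (r s : ℤ) : ℂ :=
  if 0 ≤ r ∧ 0 ≤ s then 1 else if r < 0 ∧ s < 0 then -1 else 0

theorem heckeTerm_eq {a b c : ℤ} {y : ℂ} (hq0 : q ≠ 0) (p : ℤ × ℤ) :
    heckeTerm a b c x y q p = thetaCoeff (q ^ a) p.1 * x ^ p.1 *
      (quadrantSign p.1 p.2 * (thetaCoeff (q ^ c) p.2 * (q ^ (b * p.1) * y) ^ p.2)) := by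
  simp only [heckeTerm, quadrantSign, thetaCoeff, tri, zpow_add₀ hq0,
    zpow_add₀ (by norm_num : (-1 : ℂ) ≠ 0), zpow_mul, mul_zpow]
  ring

theorem norm_quadrantSign_mul_zpow_le (hq0 : q ≠ 0) (hq : ‖q‖ ≤ 1) {b : ℤ} (hb : 0 ≤ b)
    (r s : ℤ) : ‖quadrantSign r s * (q ^ (b * r)) ^ s‖ ≤ 1 := by
  have hzpow : 0 ≤ r * s → ‖(q ^ (b * r)) ^ s‖ ≤ 1 := fun h => by
    rw [← zpow_mul, norm_zpow, mul_assoc]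
    exact zpow_le_one₀ (norm_pos_iff.mpr hq0) hq (mul_nonneg hb h)
  unfold quadrantSign
  split_ifs with hpos hneg
  · simpa using hzpow (mul_nonneg hpos.1 hpos.2)
  · simpa using hzpow (mul_nonneg_of_nonpos_of_nonpos hneg.1.le hneg.2.le)
  · simp

theorem norm_zpow_lt_one (hq0 : q ≠ 0) (hq : ‖q‖ < 1) {a : ℤ} (ha : 0 < a) : ‖q ^ a‖ < 1 := by
  rw [norm_zpow]
  exact zpow_lt_one₀ (norm_pos_iff.mpr hq0) hq ha

theorem summable_heckeTerm {a b c : ℤ} {y : ℂ} (hq0 : q ≠ 0) (hq : ‖q‖ < 1) (ha : 0 < a)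
    (hb : 0 ≤ b) (hc : 0 < c) (hx : x ≠ 0) (hy : y ≠ 0) : Summable (heckeTerm a b c x y q) := by
  have htheta : ∀ {k : ℤ} {z : ℂ}, 0 < k → z ≠ 0 →
      Summable fun n : ℤ => ‖thetaCoeff (q ^ k) n * z ^ n‖ := fun hk hz =>
    summable_norm_thetaCoeff_mul_zpow (zpow_ne_zero _ hq0) (norm_zpow_lt_one hq0 hq hk) hz
  refine (summable_norm_mul_of_norm_le ((htheta ha hx).mul_norm (htheta hc hy)) fun p =>
    norm_quadrantSign_mul_zpow_le hq0 hq.le hb p.1 p.2).of_norm.congr fun p => ?_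
  rw [heckeTerm_eq hq0, mul_zpow]
  ring

theorem hasSum_quadrantSign_mul (hq0 : q ≠ 0) (hq : ‖q‖ < 1) (hx : x ≠ 0) (hzero : theta x q = 0)
    (r : ℤ) :
    HasSum (fun s => quadrantSign r s * (thetaCoeff q s * x ^ s)) (partialTheta x q) := by
  rcases le_or_gt 0 r with hr | hr
  · have hnonneg : ∀ n : ℕ, quadrantSign r n = 1 := fun n => by simp [quadrantSign, hr]
    have hneg : ∀ n : ℕ, quadrantSign r (-(n + 1)) = 0 := fun n => by
      rw [quadrantSign, if_neg (by omega), if_neg (by omega)]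
    simpa using HasSum.of_nat_of_neg_add_one
      (f := fun s => quadrantSign r s * (thetaCoeff q s * x ^ s)) (m' := 0)
      (by simpa only [hnonneg, one_mul] using hasSum_partialTheta hq0 hq hx)
      (by simpa only [hneg, zero_mul] using hasSum_zero)
  · have hnonneg : ∀ n : ℕ, quadrantSign r n = 0 := fun n => by simp [quadrantSign, hr.not_ge]
    have hneg : ∀ n : ℕ, quadrantSign r (-(n + 1)) = -1 := fun n => by
      rw [quadrantSign, if_neg (by omega), if_pos (by omega)]
    simpa using HasSum.of_nat_of_neg_add_one
      (f := fun s => quadrantSign r s * (thetaCoeff q s * x ^ s)) (m := 0)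
      (by simpa only [hnonneg, zero_mul] using hasSum_zero)
      (by simpa only [hneg, neg_one_mul, neg_neg] using
        (hasSum_neg_partialTheta hq0 hq hx hzero).neg)

theorem heckeF_eq_tsum_partialTheta {a b c : ℤ} {y : ℂ} (hq0 : q ≠ 0) (hq : ‖q‖ < 1)
    (ha : 0 < a) (hb : 0 ≤ b) (hc : 0 < c) (hx : x ≠ 0) (hy : y ≠ 0)
    (hzero : ∀ r : ℤ, theta (q ^ (b * r) * y) (q ^ c) = 0) :
    heckeF a b c x y q =
      ∑' r : ℤ, thetaCoeff (q ^ a) r * x ^ r * partialTheta (q ^ (b * r) * y) (q ^ c) := by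
  rw [heckeF, (summable_heckeTerm hq0 hq ha hb hc hx hy).tsum_prod]
  refine tsum_congr fun r => ?_
  simp only [heckeTerm_eq hq0]
  exact ((hasSum_quadrantSign_mul (zpow_ne_zero c hq0) (norm_zpow_lt_one hq0 hq hc)
    (mul_ne_zero (zpow_ne_zero _ hq0) hy) (hzero r) r).mul_left _).tsum_eq

theorem heckeF_four_four_one_eq_tsum (hq0 : q ≠ 0) (hq : ‖q‖ < 1) :
    heckeF 4 4 1 (q ^ 4) (q ^ 3) q =
      -∑' r : ℤ, thetaCoeff (q ^ 4) r * partialTheta (q ^ (4 * r - 1)) q := by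
  have hy : ∀ r : ℤ, q ^ (4 * r) * q ^ 3 = q ^ (4 * (r + 1) - 1) := fun r => by
    rw [← zpow_natCast, ← zpow_add₀ hq0]
    congr 1
    push_cast
    ring
  rw [heckeF_eq_tsum_partialTheta hq0 hq (by norm_num) (by norm_num) (by norm_num)
    (pow_ne_zero 4 hq0) (pow_ne_zero 3 hq0) fun r => by
      rw [hy, zpow_one]; exact theta_zpow_eq_zero hq0 hq _,
    ← (Equiv.addRight (1 : ℤ)).tsum_eq fun r =>
      thetaCoeff (q ^ 4) r * partialTheta (q ^ (4 * r - 1)) q, ← tsum_neg]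
  refine tsum_congr fun r => ?_
  rw [Equiv.coe_addRight, thetaCoeff_add_one (pow_ne_zero 4 hq0), hy, zpow_one, zpow_ofNat]
  ring

theorem thetaCoeff_mul_neg_zpow (x q : ℂ) (n : ℤ) :
    thetaCoeff q n * (-x) ^ n = q ^ tri n * x ^ n := by
  have hsign : (-1 : ℂ) ^ n * (-1) ^ n = 1 := by rw [← mul_zpow]; norm_num
  rw [thetaCoeff, ← neg_one_mul x, mul_zpow]
  linear_combination q ^ tri n * x ^ n * hsign

theorem theta_mul_tsum_partialTheta_two_mul_add (hq0 : q ≠ 0) (hq : ‖q‖ < 1) (m : ℤ) :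
    theta q (q ^ 2) * ∑' n, thetaCoeff (q ^ 2) n * partialTheta (q ^ (2 * (n + m) - 1)) q =
      -(q ^ tri (2 * m) * eulerPhi q ^ 3) := by
  obtain ⟨M, hM⟩ := exists_norm_partialTheta_zpow_le hq0 hq
  have hexp : ∀ n, 2 * (n + m) - 1 = 2 * n + (2 * m - 1) := fun n => by ring
  have htri : tri (1 - 2 * m) = tri (2 * m) := by
    linarith [two_mul_tri (1 - 2 * m), two_mul_tri (2 * m)]
  simp only [hexp]
  rw [← tsum_zpow_tri_mul_tsum_thetaCoeff hq0 hq
    (c := fun k => partialTheta (q ^ (k + (2 * m - 1))) q) fun k => hM _]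
  simp only [add_assoc, tsum_thetaCoeff_mul_partialTheta_add hq0 hq]
  rw [tsum_eq_single (1 - 2 * m) fun k hk => by rw [if_neg (by omega), mul_zero],
    if_pos (by ring), htri]
  ring

theorem theta_mul_theta_mul_heckeF (hq0 : q ≠ 0) (hq : ‖q‖ < 1) :
    theta q (q ^ 2) * theta (q ^ 2) (q ^ 4) * heckeF 4 4 1 (q ^ 4) (q ^ 3) q =
      eulerPhi q ^ 3 * theta (-q) (q ^ 6) := by
  obtain ⟨M, hM⟩ := exists_norm_partialTheta_zpow_le hq0 hq
  have houter := tsum_zpow_tri_mul_tsum_thetaCoeff (pow_ne_zero 2 hq0)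
    (norm_pow_lt_one hq two_ne_zero) (c := fun k => partialTheta (q ^ (2 * k - 1)) q) fun k => hM _
  rw [← pow_mul] at houter
  calc theta q (q ^ 2) * theta (q ^ 2) (q ^ 4) * heckeF 4 4 1 (q ^ 4) (q ^ 3) q
      = -(theta q (q ^ 2) * (theta (q ^ 2) (q ^ 4) *
          ∑' l, thetaCoeff (q ^ 4) l * partialTheta (q ^ (2 * (2 * l) - 1)) q)) := by
        rw [heckeF_four_four_one_eq_tsum hq0 hq]
        simp only [← mul_assoc, Int.reduceMul]
        ring
    _ = -∑' m, (q ^ 2) ^ tri m * (theta q (q ^ 2) *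
          ∑' n, thetaCoeff (q ^ 2) n * partialTheta (q ^ (2 * (n + m) - 1)) q) := by
        rw [← houter, ← tsum_mul_left]
        simp only [mul_left_comm]
    _ = eulerPhi q ^ 3 * theta (-q) (q ^ 6) := by
        simp only [theta_mul_tsum_partialTheta_two_mul_add hq0 hq]
        rw [theta_eq_tsum, ← tsum_mul_left, ← tsum_neg]
        refine tsum_congr fun m => ?_
        rw [thetaCoeff_mul_neg_zpow, tri_two_mul, zpow_add₀ hq0, zpow_mul,
          show q ^ 6 = q ^ 2 * q ^ 4 by ring, mul_zpow, zpow_ofNat]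
        ring

/-! ### Evaluation of the products -/

theorem eulerPhi_eq_prod_range (k : ℕ) [NeZero k] (hq : ‖q‖ < 1) :
    eulerPhi q = ∏ j ∈ Finset.range k, qPochhammer (q ^ (j + 1)) (q ^ k) := by
  rw [eulerPhi, qPochhammer_eq_prod k q hq, Finset.prod_range]
  simp only [pow_succ']

theorem theta_self_pow_succ (hq0 : q ≠ 0) (hq : ‖q‖ < 1) (k : ℕ) :
    theta q (q ^ (k + 1)) =
      eulerPhi (q ^ (k + 1)) * qPochhammer q (q ^ (k + 1)) * qPochhammer (q ^ k) (q ^ (k + 1)) := by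
  rw [theta_eq_qPochhammer (pow_ne_zero _ hq0) (norm_pow_lt_one hq k.succ_ne_zero) hq0, pow_succ,
    mul_div_cancel_right₀ _ hq0]

theorem theta_self_pow_two_mul (hq0 : q ≠ 0) (hq : ‖q‖ < 1) :
    theta q (q ^ 2) * eulerPhi (q ^ 2) = eulerPhi q ^ 2 := by
  rw [theta_self_pow_succ hq0 hq 1, eulerPhi_eq_prod_range 2 hq]
  simp only [eulerPhi, Finset.prod_range_succ, Finset.prod_range_zero, Nat.reduceAdd, zero_add,
    pow_one, one_mul]
  ring

theorem theta_self_pow_three (hq0 : q ≠ 0) (hq : ‖q‖ < 1) : theta q (q ^ 3) = eulerPhi q := by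
  rw [theta_self_pow_succ hq0 hq 2, eulerPhi_eq_prod_range 3 hq]
  simp only [eulerPhi, Finset.prod_range_succ, Finset.prod_range_zero, Nat.reduceAdd, zero_add,
    pow_one, one_mul]
  ring

theorem theta_self_pow_four_mul (hq0 : q ≠ 0) (hq : ‖q‖ < 1) :
    theta q (q ^ 4) * eulerPhi (q ^ 2) = eulerPhi q * eulerPhi (q ^ 4) := by
  rw [theta_self_pow_succ hq0 hq 3, eulerPhi_eq_prod_range 4 hq,
    eulerPhi_eq_prod_range 2 (norm_pow_lt_one hq two_ne_zero)]
  simp only [eulerPhi, Finset.prod_range_succ, Finset.prod_range_zero, ← pow_mul, Nat.reduceAdd,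
    Nat.reduceMul, zero_add, pow_one, one_mul]
  ring

theorem theta_self_pow_six_mul (hq0 : q ≠ 0) (hq : ‖q‖ < 1) :
    theta q (q ^ 6) * (eulerPhi (q ^ 2) * eulerPhi (q ^ 3)) =
      eulerPhi q * eulerPhi (q ^ 6) ^ 2 := by
  rw [theta_self_pow_succ hq0 hq 5, eulerPhi_eq_prod_range 6 hq,
    eulerPhi_eq_prod_range 3 (norm_pow_lt_one hq two_ne_zero),
    eulerPhi_eq_prod_range 2 (norm_pow_lt_one hq three_ne_zero)]
  simp only [eulerPhi, Finset.prod_range_succ, Finset.prod_range_zero, ← pow_mul, Nat.reduceAdd,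
    Nat.reduceMul, zero_add, pow_one, one_mul]
  ring

theorem theta_neg_mul_theta (hq0 : q ≠ 0) (hq : ‖q‖ < 1) (hx : x ≠ 0) :
    theta (-x) q * theta x q * eulerPhi (q ^ 2) = eulerPhi q ^ 2 * theta (x ^ 2) (q ^ 2) := by
  rw [theta_eq_qPochhammer hq0 hq hx, theta_eq_qPochhammer hq0 hq (neg_ne_zero.mpr hx),
    theta_eq_qPochhammer (pow_ne_zero 2 hq0) (norm_pow_lt_one hq two_ne_zero) (pow_ne_zero 2 hx),
    ← qPochhammer_neg_mul_qPochhammer x hq, ← div_pow, ← qPochhammer_neg_mul_qPochhammer _ hq,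
    div_neg]
  ring

theorem theta_neg_self_pow_six_mul (hq0 : q ≠ 0) (hq : ‖q‖ < 1) :
    theta (-q) (q ^ 6) * (eulerPhi q * eulerPhi (q ^ 4) * eulerPhi (q ^ 6)) =
      eulerPhi (q ^ 2) ^ 2 * eulerPhi (q ^ 3) * eulerPhi (q ^ 12) := by
  have hφ : ∀ {k : ℕ}, k ≠ 0 → eulerPhi (q ^ k) ≠ 0 := fun hk =>
    eulerPhi_ne_zero (norm_pow_lt_one hq hk)
  have hsix := theta_self_pow_six_mul hq0 hq
  have htwelve := theta_self_pow_six_mul (pow_ne_zero 2 hq0) (norm_pow_lt_one hq two_ne_zero)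
  have hproduct :=
    theta_neg_mul_theta (pow_ne_zero 6 hq0) (norm_pow_lt_one hq (by norm_num)) hq0
  simp only [← pow_mul, Nat.reduceMul] at htwelve hproduct
  have hcancel : eulerPhi (q ^ 6) ^ 2 * eulerPhi (q ^ 12) ≠ 0 :=
    mul_ne_zero (pow_ne_zero 2 (hφ (by norm_num))) (hφ (by norm_num))
  refine mul_right_cancel₀ hcancel ?_
  linear_combination
    eulerPhi (q ^ 2) * eulerPhi (q ^ 3) * eulerPhi (q ^ 4) * eulerPhi (q ^ 6) * hproduct -
      theta (-q) (q ^ 6) * eulerPhi (q ^ 4) * eulerPhi (q ^ 6) * eulerPhi (q ^ 12) * hsix +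
      eulerPhi (q ^ 6) ^ 2 * eulerPhi (q ^ 2) * eulerPhi (q ^ 3) * htwelve

theorem heckeF_four_four_one_mul (hq0 : q ≠ 0) (hq : ‖q‖ < 1) :
    heckeF 4 4 1 (q ^ 4) (q ^ 3) q * eulerPhi (q ^ 6) =
      eulerPhi (q ^ 2) * (eulerPhi (q ^ 3) * eulerPhi (q ^ 12)) := by
  have hq2 : ‖q ^ 2‖ < 1 := norm_pow_lt_one hq two_ne_zero
  have htwo := theta_self_pow_two_mul hq0 hq
  have hfour := theta_self_pow_two_mul (pow_ne_zero 2 hq0) hq2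
  simp only [← pow_mul, Nat.reduceMul] at hfour
  have hcancel : eulerPhi q ^ 2 * eulerPhi (q ^ 2) ^ 2 ≠ 0 :=
    mul_ne_zero (pow_ne_zero 2 (eulerPhi_ne_zero hq)) (pow_ne_zero 2 (eulerPhi_ne_zero hq2))
  refine mul_right_cancel₀ hcancel ?_
  linear_combination
    eulerPhi (q ^ 2) * eulerPhi (q ^ 4) * eulerPhi (q ^ 6) * theta_mul_theta_mul_heckeF hq0 hq +
      eulerPhi q ^ 2 * eulerPhi (q ^ 2) * theta_neg_self_pow_six_mul hq0 hq -
      heckeF 4 4 1 (q ^ 4) (q ^ 3) q * eulerPhi (q ^ 6) * eulerPhi (q ^ 2) ^ 2 * htwo -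
      heckeF 4 4 1 (q ^ 4) (q ^ 3) q * eulerPhi (q ^ 6) * theta q (q ^ 2) * eulerPhi (q ^ 2) * hfour

theorem eulerJ_eq_eulerPhi (hq0 : q ≠ 0) (hq : ‖q‖ < 1) {m : ℤ} (hm : 0 < m) :
    eulerJ m q = eulerPhi (q ^ m) := by
  rw [eulerJ, thetaJ, mul_comm, zpow_mul, zpow_ofNat,
    theta_self_pow_three (zpow_ne_zero m hq0) (norm_zpow_lt_one hq0 hq hm)]

theorem heckeF_four_four_one_eq (hq0 : q ≠ 0) (hq : ‖q‖ < 1) :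
    heckeF 4 4 1 (q ^ 4) (q ^ 3) q = eulerJ 2 q * thetaJ 3 12 q := by
  have htheta := theta_self_pow_four_mul (pow_ne_zero 3 hq0) (norm_pow_lt_one hq three_ne_zero)
  simp only [← pow_mul, Nat.reduceMul] at htheta
  refine mul_right_cancel₀ (eulerPhi_ne_zero (norm_pow_lt_one hq (by norm_num : 6 ≠ 0))) ?_
  rw [heckeF_four_four_one_mul hq0 hq, eulerJ_eq_eulerPhi hq0 hq two_pos, thetaJ, mul_assoc]
  simp only [zpow_ofNat, htheta]

/-! ### The string function -/

theorem qPow_add (τ : UpperHalfPlane) (x y : ℝ) : qPow τ (x + y) = qPow τ x * qPow τ y := by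
  rw [qPow, qPow, qPow, ← Complex.exp_add]
  congr 1
  push_cast
  ring

theorem qPow_ne_zero (τ : UpperHalfPlane) (x : ℝ) : qPow τ x ≠ 0 := Complex.exp_ne_zero _

theorem qPow_intCast (τ : UpperHalfPlane) (n : ℤ) : qPow τ n = qPow τ 1 ^ n := by
  rw [qPow, qPow, ← Complex.exp_int_mul]
  congr 1
  push_cast
  ring

theorem norm_qPow_one_lt_one (τ : UpperHalfPlane) : ‖qPow τ 1‖ < 1 := by
  simpa [qPow] using UpperHalfPlane.norm_exp_two_pi_I_lt_one τ

theorem eta_natCast_mul (τ : UpperHalfPlane) (k : ℕ) :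
    ModularForm.eta (k * (τ : ℂ)) = qPow τ (k / 24) * eulerPhi (qPow τ 1 ^ k) := by
  rw [ModularForm.eta, eulerPhi, qPochhammer]
  congr 1
  · rw [Function.Periodic.qParam, qPow]
    congr 1
    push_cast
    ring
  · refine tprod_congr fun n => ?_
    rw [ModularForm.eta_q_eq_pow, ← pow_succ', qPow, ← Complex.exp_nat_mul _ k]
    congr 3
    push_cast
    ring

theorem mem_lattice_six_three_one_iff (p : ℝ × ℝ) :
    (p ∈ shiftedLattice 6 3 1 ∨ (1 / 2 - p.1, 1 / 2 + p.2) ∈ shiftedLattice 6 3 1) ↔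
      ∃ X Y : ℤ, X % 4 = 1 ∧ Y % 6 = 1 ∧ p = ((X : ℝ) / 4, (Y : ℝ) / 12) := by
  obtain ⟨x, y⟩ := p
  simp only [shiftedLattice, Set.mem_ofPred_eq, Prod.mk.injEq]
  constructor
  · rintro (⟨i, k, hi, hk⟩ | ⟨i, k, hi, hk⟩) <;> push_cast at hi hk
    · exact ⟨4 * i + 1, 12 * k + 1, by omega, by omega, by push_cast; linarith,
        by push_cast; linarith⟩
    · exact ⟨1 - 4 * i, 12 * k - 5, by omega, by omega, by push_cast; linarith,
        by push_cast; linarith⟩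
  · rintro ⟨X, Y, hX, hY, rfl, rfl⟩
    obtain ⟨i, rfl⟩ : ∃ i, X = 4 * i + 1 := ⟨X / 4, by omega⟩
    rcases (by omega : Y % 12 = 1 ∨ Y % 12 = 7) with hY | hY
    · obtain ⟨k, rfl⟩ : ∃ k, Y = 12 * k + 1 := ⟨Y / 12, by omega⟩
      exact Or.inl ⟨i, k, by push_cast; ring, by push_cast; ring⟩
    · obtain ⟨k, rfl⟩ : ∃ k, Y = 12 * k + 7 := ⟨Y / 12, by omega⟩
      exact Or.inr ⟨-i, k + 1, by push_cast; ring, by push_cast; ring⟩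

theorem neg_abs_div_four_lt_and_le_iff (X Y : ℤ) :
    (-|(X : ℝ) / 4| < (Y : ℝ) / 12 ∧ (Y : ℝ) / 12 ≤ |(X : ℝ) / 4|) ↔
      -(3 * |X|) < Y ∧ Y ≤ 3 * |X| := by
  have habs : |(X : ℝ) / 4| = |(X : ℝ)| / 4 := by rw [abs_div]; norm_num
  rw [habs, ← Int.cast_lt (R := ℝ), ← Int.cast_le (R := ℝ)]
  push_cast
  constructor <;> rintro ⟨hlower, hupper⟩ <;> constructor <;> linarith

theorem mem_stringIndex_six_three_one_iff (p : ℝ × ℝ) :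
    p ∈ stringIndex 6 3 1 ↔ ∃ X Y : ℤ, X % 4 = 1 ∧ Y % 6 = 1 ∧
      (-(3 * |X|) < Y ∧ Y ≤ 3 * |X|) ∧ p = ((X : ℝ) / 4, (Y : ℝ) / 12) := by
  rw [stringIndex, Set.mem_ofPred_eq, ← and_assoc, mem_lattice_six_three_one_iff]
  constructor
  · rintro ⟨hbounds, X, Y, hX, hY, rfl⟩
    exact ⟨X, Y, hX, hY, (neg_abs_div_four_lt_and_le_iff X Y).mp hbounds, rfl⟩
  · rintro ⟨X, Y, hX, hY, hbounds, rfl⟩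
    exact ⟨(neg_abs_div_four_lt_and_le_iff X Y).mpr hbounds, X, Y, hX, hY, rfl⟩

/-- The odd number `(-1)^u (2u + 1)`. Every integer congruent to `1` modulo `4` is of this form,
for exactly two values `u` and `-1 - u`, one of them nonnegative. -/
def altOdd (u : ℤ) : ℤ := if u % 2 = 0 then 2 * u + 1 else -(2 * u + 1)

theorem altOdd_sq (u : ℤ) : altOdd u ^ 2 = (2 * u + 1) ^ 2 := by
  rw [altOdd]
  split_ifs <;> ring

theorem abs_altOdd (u : ℤ) : |altOdd u| = |2 * u + 1| :=
  (sq_eq_sq_iff_abs_eq_abs _ _).mp (altOdd_sq u)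

theorem altOdd_emod_four (u : ℤ) : altOdd u % 4 = 1 := by
  rw [altOdd]
  split_ifs <;> omega

theorem altOdd_eq_altOdd_iff {u v : ℤ} : altOdd u = altOdd v ↔ u = v ∨ u = -1 - v := by
  simp only [altOdd]
  split_ifs <;> omega

theorem exists_nonneg_altOdd_eq {X : ℤ} (hX : X % 4 = 1) : ∃ u, 0 ≤ u ∧ altOdd u = X := by
  rcases le_or_gt 0 X with hpos | hneg
  · exact ⟨(X - 1) / 2, by omega, by rw [altOdd, if_pos] <;> omega⟩
  · exact ⟨(-X - 1) / 2, by omega, by rw [altOdd, if_neg] <;> omega⟩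

/-- The pairs `(r, s)` that occur in a Hecke-type double sum. -/
def sameSign : Set (ℤ × ℤ) := {p | 0 ≤ p.1 ∧ 0 ≤ p.2 ∨ p.1 < 0 ∧ p.2 < 0}

/-- The point of the Kac–Peterson double sum that corresponds to the pair `(r, s)`, which makes
`8x² - 6y² = 11/24 + 4r + 3s + 4r(r-1)/2 + 4rs + s(s-1)/2`. -/
def toIndex (p : ℤ × ℤ) : ℝ × ℝ := ((altOdd (p.1 + p.2) : ℝ) / 4, ((1 - 6 * p.2 : ℤ) : ℝ) / 12)

theorem mapsTo_toIndex : Set.MapsTo toIndex sameSign (stringIndex 6 3 1) := by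
  rintro ⟨r, s⟩ hrs
  simp only [sameSign, Set.mem_ofPred_eq] at hrs
  refine (mem_stringIndex_six_three_one_iff _).mpr
    ⟨altOdd (r + s), 1 - 6 * s, altOdd_emod_four _, by omega, ?_, rfl⟩
  rw [abs_altOdd]
  rcases abs_cases (2 * (r + s) + 1) with habs | habs <;> omega

theorem injOn_toIndex : Set.InjOn toIndex sameSign := by
  rintro ⟨r, s⟩ hrs ⟨r', s'⟩ hrs' heq
  simp only [toIndex, Prod.mk.injEq, div_left_inj', ne_eq, OfNat.ofNat_ne_zero,
    not_false_eq_true, Int.cast_inj, altOdd_eq_altOdd_iff] at heq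
  simp only [sameSign, Set.mem_ofPred_eq] at hrs hrs'
  ext <;> dsimp only <;> omega

theorem surjOn_toIndex : Set.SurjOn toIndex sameSign (stringIndex 6 3 1) := by
  intro p hp
  obtain ⟨X, Y, hX, hY, hbounds, rfl⟩ := (mem_stringIndex_six_three_one_iff p).mp hp
  obtain ⟨s, rfl⟩ : ∃ s, Y = 1 - 6 * s := ⟨(1 - Y) / 6, by omega⟩
  obtain ⟨u, hu, rfl⟩ := exists_nonneg_altOdd_eq hX
  rw [abs_altOdd, abs_of_nonneg (by omega)] at hbounds
  obtain ⟨v, hv, hvs⟩ : ∃ v, altOdd v = altOdd u ∧ (v - s, s) ∈ sameSign := by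
    simp only [altOdd_eq_altOdd_iff, sameSign, Set.mem_ofPred_eq]
    rcases le_or_gt 0 s with hs | hs
    · exact ⟨u, by omega, by omega⟩
    · exact ⟨-1 - u, by omega, by omega⟩
  exact ⟨(v - s, s), hvs, by simp only [toIndex, sub_add_cancel, hv]⟩

theorem bijOn_toIndex : Set.BijOn toIndex sameSign (stringIndex 6 3 1) :=
  ⟨mapsTo_toIndex, injOn_toIndex, surjOn_toIndex⟩

theorem sign_toIndex {r s : ℤ} (hrs : (r, s) ∈ sameSign) :
    (if 0 ≤ (toIndex (r, s)).1 then 1 else -1) = quadrantSign r s * (-1) ^ (r + s) := by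
  have hnonneg : 0 ≤ (toIndex (r, s)).1 ↔ 0 ≤ altOdd (r + s) := by
    rw [toIndex, le_div_iff₀ four_pos, zero_mul, Int.cast_nonneg_iff]
  simp only [hnonneg, quadrantSign, altOdd]
  rcases Int.even_or_odd (r + s) with hparity | hparity <;> rw [hparity.neg_one_zpow]
  · rw [if_pos (Int.even_iff.mp hparity)]
    rcases hrs with hpos | hneg
    · rw [if_pos hpos, if_pos (by omega), one_mul]
    · rw [if_neg (by omega), if_neg (by omega), if_pos hneg, mul_one]
  · rw [Int.odd_iff.mp hparity, if_neg one_ne_zero]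
    rcases hrs with hpos | hneg
    · rw [if_neg (by omega), if_pos hpos, one_mul]
    · rw [if_pos (by omega), if_neg (by omega), if_pos hneg, neg_one_mul, neg_neg]

theorem quadraticForm_toIndex (r s : ℤ) :
    8 * (toIndex (r, s)).1 ^ 2 - 6 * (toIndex (r, s)).2 ^ 2 =
      11 / 24 + ((4 * r + 3 * s + (4 * tri r + 4 * r * s + 1 * tri s) : ℤ) : ℝ) := by
  have hsq : (altOdd (r + s) : ℝ) ^ 2 = (2 * (r + s) + 1) ^ 2 := mod_cast altOdd_sq (r + s)
  have hr : (2 : ℝ) * tri r = r * (r - 1) := mod_cast two_mul_tri r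
  have hs : (2 : ℝ) * tri s = s * (s - 1) := mod_cast two_mul_tri s
  simp only [toIndex]
  push_cast
  linear_combination hsq / 2 - 2 * hr - hs / 2

theorem heckeTerm_zpow_zpow {a b c k l : ℤ} (hq0 : q ≠ 0) (r s : ℤ) :
    heckeTerm a b c (q ^ k) (q ^ l) q (r, s) = quadrantSign r s * (-1) ^ (r + s) *
      q ^ (k * r + l * s + (a * tri r + b * r * s + c * tri s)) := by
  rw [zpow_add₀ hq0 (k * r + l * s), zpow_add₀ hq0 (k * r), zpow_mul, zpow_mul, heckeTerm,
    quadrantSign, tri, tri]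
  ring

theorem stringTerm_toIndex (τ : UpperHalfPlane) {p : ℤ × ℤ} (hp : p ∈ sameSign) :
    stringTerm 6 τ (toIndex p) = qPow τ (11 / 24) *
      heckeTerm 4 4 1 (qPow τ 1 ^ 4) (qPow τ 1 ^ 3) (qPow τ 1) p := by
  obtain ⟨r, s⟩ := p
  have hterm := heckeTerm_zpow_zpow (a := 4) (b := 4) (c := 1) (k := 4) (l := 3)
    (qPow_ne_zero τ 1) r s
  rw [zpow_ofNat, zpow_ofNat] at hterm
  have hform := quadraticForm_toIndex r s
  rw [show (8 : ℝ) = (6 : ℤ) + 2 by norm_num, show (6 : ℝ) = (6 : ℤ) by norm_num] at hform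
  rw [stringTerm, sign_toIndex hp, hform, qPow_add, qPow_intCast, hterm]
  ring

theorem support_heckeTerm_subset (a b c : ℤ) (x y q : ℂ) :
    Function.support (heckeTerm a b c x y q) ⊆ sameSign := by
  refine Function.support_subset_iff'.mpr fun p hp => ?_
  obtain ⟨hpos, hneg⟩ := not_or.mp hp
  rw [heckeTerm, if_neg hpos, if_neg hneg, zero_mul]

theorem hasSum_stringTerm (τ : UpperHalfPlane) :
    HasSum (fun p : stringIndex 6 3 1 => stringTerm 6 τ p)
      (qPow τ (11 / 24) * heckeF 4 4 1 (qPow τ 1 ^ 4) (qPow τ 1 ^ 3) (qPow τ 1)) := by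
  have hq0 := qPow_ne_zero τ 1
  have hsum := (summable_heckeTerm (a := 4) (b := 4) (c := 1) hq0 (norm_qPow_one_lt_one τ)
    (by norm_num) (by norm_num) (by norm_num) (pow_ne_zero 4 hq0) (pow_ne_zero 3 hq0)).hasSum
  rw [← hasSum_subtype_iff_of_support_subset (support_heckeTerm_subset _ _ _ _ _ _)] at hsum
  rw [← (Set.BijOn.equiv toIndex bijOn_toIndex).hasSum_iff]
  exact (hsum.mul_left (qPow τ (11 / 24))).congr_fun fun p => stringTerm_toIndex τ p.2

theorem stringFunction_eq (τ : UpperHalfPlane) :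
    stringFunction 6 3 1 τ = (ModularForm.eta (τ : ℂ) ^ 3)⁻¹ *
      (qPow τ (11 / 24) * heckeF 4 4 1 (qPow τ 1 ^ 4) (qPow τ 1 ^ 3) (qPow τ 1)) := by
  rw [stringFunction, (hasSum_stringTerm τ).tsum_eq]

theorem stringFunction_eq_heckeF (τ : UpperHalfPlane) :
    stringFunction 6 3 1 τ = qPow τ (sExponent 1 3 6) / eulerJ 1 (qPow τ 1) ^ 3 *
      heckeF 4 4 1 (qPow τ 1 ^ 4) (qPow τ 1 ^ 3) (qPow τ 1) := by
  have heta : ModularForm.eta (τ : ℂ) = qPow τ (1 / 24) * eulerPhi (qPow τ 1) := by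
    simpa using eta_natCast_mul τ 1
  have hexp : qPow τ (11 / 24) = qPow τ (1 / 24) ^ 3 * qPow τ (sExponent 1 3 6) := by
    rw [pow_three, ← qPow_add, ← qPow_add, ← qPow_add]
    congr 1
    norm_num [sExponent]
  rw [stringFunction_eq, heta, hexp, mul_pow, mul_inv, mul_assoc (qPow τ (1 / 24) ^ 3),
    mul_mul_mul_comm, inv_mul_cancel₀ (pow_ne_zero 3 (qPow_ne_zero τ _)), one_mul,
    eulerJ_eq_eulerPhi (qPow_ne_zero τ 1) (norm_qPow_one_lt_one τ) one_pos, zpow_one]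
  ring

theorem qPow_mul_heckeF_mul_eta (τ : UpperHalfPlane) :
    qPow τ (11 / 24) * heckeF 4 4 1 (qPow τ 1 ^ 4) (qPow τ 1 ^ 3) (qPow τ 1) *
        ModularForm.eta (6 * (τ : ℂ)) =
      ModularForm.eta (2 * (τ : ℂ)) * ModularForm.eta (3 * (τ : ℂ)) *
        ModularForm.eta (12 * (τ : ℂ)) := by
  have hhecke := heckeF_four_four_one_mul (qPow_ne_zero τ 1) (norm_qPow_one_lt_one τ)
  have hexp : qPow τ (11 / 24) * qPow τ (6 / 24) =
      qPow τ (2 / 24) * qPow τ (3 / 24) * qPow τ (12 / 24) := by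
    simp only [← qPow_add]
    norm_num
  have htwo := eta_natCast_mul τ 2
  have hthree := eta_natCast_mul τ 3
  have hsix := eta_natCast_mul τ 6
  have htwelve := eta_natCast_mul τ 12
  push_cast at htwo hthree hsix htwelve
  rw [htwo, hthree, hsix, htwelve]
  linear_combination qPow τ (11 / 24) * qPow τ (6 / 24) * hhecke +
    eulerPhi (qPow τ 1 ^ 2) * eulerPhi (qPow τ 1 ^ 3) * eulerPhi (qPow τ 1 ^ 12) * hexp

theorem stringFunction_eq_eta (τ : UpperHalfPlane) :
    stringFunction 6 3 1 τ =
      (ModularForm.eta (τ : ℂ) ^ 3)⁻¹ * ModularForm.eta (2 * (τ : ℂ)) *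
        ModularForm.eta (3 * (τ : ℂ)) * (ModularForm.eta (6 * (τ : ℂ)))⁻¹ *
        ModularForm.eta (12 * (τ : ℂ)) := by
  have hsix : ModularForm.eta (6 * (τ : ℂ)) ≠ 0 := by
    have heta := eta_natCast_mul τ 6
    push_cast at heta
    rw [heta]
    exact mul_ne_zero (qPow_ne_zero τ _)
      (eulerPhi_ne_zero (norm_pow_lt_one (norm_qPow_one_lt_one τ) (by norm_num)))
  rw [stringFunction_eq, eq_div_of_mul_eq hsix (qPow_mul_heckeF_mul_eta τ)]
  ring

end StringFn

end

theorem mainTheorem8 :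
    -- the double-sum evaluation `f_{4,4,1}(q⁴, q³, q) = J₂ J_{3,12}`
    (∀ q : ℂ, q ≠ 0 → ‖q‖ < 1 →
      Summable (StringFn.heckeTerm 4 4 1 (q ^ 4) (q ^ 3) q) ∧
      StringFn.heckeF 4 4 1 (q ^ 4) (q ^ 3) q =
        StringFn.eulerJ 2 q * StringFn.thetaJ 3 12 q) ∧
    -- the string function `c^{33}_{51}`: its expression through that double sum,
    -- and its evaluation as an eta quotient
    (∀ τ : UpperHalfPlane,
      Summable (fun p : StringFn.stringIndex 6 3 1 => StringFn.stringTerm 6 τ p) ∧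
      StringFn.stringFunction 6 3 1 τ =
        StringFn.qPow τ (StringFn.sExponent 1 3 6) /
            StringFn.eulerJ 1 (StringFn.qPow τ 1) ^ 3 *
          StringFn.heckeF 4 4 1 (StringFn.qPow τ 1 ^ 4) (StringFn.qPow τ 1 ^ 3)
            (StringFn.qPow τ 1) ∧
      StringFn.stringFunction 6 3 1 τ =
        (ModularForm.eta (τ : ℂ) ^ 3)⁻¹ * ModularForm.eta (2 * (τ : ℂ)) *
          ModularForm.eta (3 * (τ : ℂ)) * (ModularForm.eta (6 * (τ : ℂ)))⁻¹ *
          ModularForm.eta (12 * (τ : ℂ))) :=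
  ⟨fun _ hq0 hq => ⟨StringFn.summable_heckeTerm hq0 hq four_pos zero_le_four one_pos
      (pow_ne_zero 4 hq0) (pow_ne_zero 3 hq0), StringFn.heckeF_four_four_one_eq hq0 hq⟩,
    fun τ => ⟨(StringFn.hasSum_stringTerm τ).summable, StringFn.stringFunction_eq_heckeF τ,
      StringFn.stringFunction_eq_eta τ⟩⟩
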